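/- Let $d\in\mathbb{N}$, $c>0$, $A_1,A_2:[0,\infty)\to\mathbb{R}^{d\times d}$, $b_1,b_2:[0,\infty)\to\mathbb{R}^d$ and $\sigma:\mathbb{R}\to\mathbb{R}$, where $\sigma$ is applied element-wise to vectors. Write $\mathbb{R}^d_+=\{x\in\mathbb{R}^d: x_i\ge 0 \text{ for all } i\}$, let $\mathcal{N}_{\mathbb{R}^d_+}(x)=\{\xi\in\mathbb{R}^d:\langle\xi,y-x\rangle\le 0\text{ for all }y\in\mathbb{R}^d_+\}$ for $x\in\mathbb{R}^d_+$ and $\mathcal{N}_{\mathbb{R}^d_+}(x)=\emptyset$ for $x\notin\mathbb{R}^d_+$ (the subdifferential of the indicator function of $\mathbb{R}^d_+$), and put $$F(t,x)=A_2(t)\,\sigma(A_1(t)x+b_1(t))-b_2(t).$$ Assume that $\|A_1(t)\|_2\,\|A_2(t)\|_2\le c$ for all $t>0$ ($\ell^2$ operator norms), that $\sigma$ is contractive, i.e. $|\sigma(r)-\sigma(s)|\le|r-s|$ for all $r,s\in\mathbb{R}$, with $\sigma(0)=0$, and that for each fixed $x\in\mathbb{R}^d$ the function $t\mapsto F(t,x)$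 is measurable and locally integrable on $[0,\infty)$ (this holds, for example, if $A_1,A_2,b_1,b_2$ are measurable and $\|A_2\|_2\|b_1\|_2+\|b_2\|_2$ is integrable on $[0,T]$ for every $T>0$). Then for every $x_0\in\mathbb{R}^d_+$ the problem $$-\frac{d}{dt}x(t)\in\mathcal{N}_{\mathbb{R}^d_+}(x(t))+A_2(t)\,\sigma(A_1(t)x(t)+b_1(t))-b_2(t)\quad\text{for a.e. }t>0,\qquad x(0)=x_0,$$ has one and only one solution $x:[0,\infty)\to\mathbb{R}^d$ that is absolutely continuous on $[0,T]$ for every $T>0$, and this solution satisfies $x(t)\in\mathbb{R}^d_+$ for all $t\ge 0$. -/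

import Mathlib

open MeasureTheory Set
open scoped Pointwise

noncomputable section

namespace ResNet

/-- The nonnegative orthant `ℝᵈ₊`. -/
def orthant (d : ℕ) : Set (EuclideanSpace ℝ (Fin d)) := {x | ∀ i, 0 ≤ x i}

/-- The normal cone of convex analysis, i.e. the subdifferential of the `0`/`∞` indicator function
of `S`. As usual it is empty at points outside `S`. -/
def normalCone {d : ℕ} (S : Set (EuclideanSpace ℝ (Fin d))) (x : EuclideanSpace ℝ (Fin d)) :
    Set (EuclideanSpace ℝ (Fin d)) :=
  {ξ | x ∈ S ∧ ∀ y ∈ S, inner ℝ ξ (y - x) ≤ 0}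

/-- The operator of a matrix on Euclidean space; its norm is the `ℓ²` operator norm. -/
abbrev op {d : ℕ} (A : Matrix (Fin d) (Fin d) ℝ) :
    EuclideanSpace ℝ (Fin d) →L[ℝ] EuclideanSpace ℝ (Fin d) :=
  Matrix.toEuclideanCLM (n := Fin d) (𝕜 := ℝ) A

/-- The activation `σ` applied element-wise. -/
def act {d : ℕ} (σ : ℝ → ℝ) (z : EuclideanSpace ℝ (Fin d)) : EuclideanSpace ℝ (Fin d) :=
  WithLp.toLp 2 (fun i => σ (z i))

/-- The forcing `F(t, x) = A₂(t) σ(A₁(t) x + b₁(t)) - b₂(t)`. -/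
def forcing {d : ℕ} (A₁ A₂ : ℝ → Matrix (Fin d) (Fin d) ℝ) (b₁ b₂ : ℝ → EuclideanSpace ℝ (Fin d))
    (σ : ℝ → ℝ) (t : ℝ) (x : EuclideanSpace ℝ (Fin d)) : EuclideanSpace ℝ (Fin d) :=
  op (A₂ t) (act σ (op (A₁ t) x + b₁ t)) - b₂ t

/-- `x` restricted to `[0, ∞)` is an absolutely continuous solution (absolutely continuous on every
`[0, T]`) of `-x'(t) ∈ N(x(t)) + F(t, x(t))` for a.e. `t > 0`, `x(0) = x₀`, with `N` the normal cone
of the orthant. Only the values of `x` and `F` at times `t ≥ 0` matter. -/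
structure IsSolution {d : ℕ} (F : ℝ → EuclideanSpace ℝ (Fin d) → EuclideanSpace ℝ (Fin d))
    (x₀ : EuclideanSpace ℝ (Fin d)) (x : ℝ → EuclideanSpace ℝ (Fin d)) : Prop where
  absolutelyContinuous : ∀ T : ℝ, 0 < T → AbsolutelyContinuousOnInterval x 0 T
  inclusion : ∀ᵐ t ∂(volume.restrict (Ioi (0 : ℝ))),
    ∃ v, HasDerivAt x v t ∧ -v ∈ normalCone (orthant d) (x t) + {F t (x t)}
  initial : x 0 = x₀

end ResNet

end

namespace ResNet

open Filter Topology

/-! The normal cone of the orthant splits by coordinates, so for a forcing `f` of time alone the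
problem is solved explicitly by Skorokhod reflection: add to each coordinate of the free path the
running supremum of its negative part. This term is nondecreasing and grows only where the reflected
coordinate vanishes (`deriv_pushing_eq_zero`), which is exactly membership of the normal cone
(`reflectedPath_inclusion`).

The forcing is `c`-Lipschitz in space (`norm_forcing_sub_le`). Reflection is Lipschitz and causal in
`f` (`norm_reflectedPath_sub_le`), so feeding a path through the forcing and reflecting is a
contraction in an exponentially weighted sup norm on the whole line; its fixed point is a global
solution (`exists_eq_reflectedPath`). Uniqueness is Gronwall's argument together with monotonicity
of the normal cone (`inner_sub_velocity_le`). -/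

/-- The running supremum of the negative part of `u`: the least amount by which a path `u` has to
be pushed upwards, in a nondecreasing way, to remain nonnegative. -/
noncomputable def pushing (u : ℝ → ℝ) (t : ℝ) : ℝ := sSup ((fun s => max 0 (-u s)) '' Iic t)

/-! ### One-dimensional Skorokhod reflection. -/

section Pushing

variable {u v h : ℝ → ℝ}

/-- Times `s ≤ 0` contribute nothing, and after time `0` the path falls by at most the increase of
`h`. -/
lemma bddAbove_image_negPart (hh : Monotone h) (hu : ∀ s t, s ≤ t → |u t - u s| ≤ h t - h s)
    (h0 : ∀ s ≤ 0, 0 ≤ u s) (t : ℝ) : BddAbove ((fun s => max 0 (-u s)) '' Iic t) := by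
  refine ⟨|h t - h 0|, ?_⟩
  rintro _ ⟨s, hs, rfl⟩
  refine max_le (abs_nonneg _) ?_
  rcases le_total s 0 with h1 | h1
  · linarith [h0 s h1, abs_nonneg (h t - h 0)]
  · linarith [neg_abs_le (u s - u 0), hu 0 s h1, hh (mem_Iic.1 hs), le_abs_self (h t - h 0),
      h0 0 le_rfl]

lemma pushing_le {t C : ℝ} (hC : 0 ≤ C) (H : ∀ s ≤ t, -u s ≤ C) : pushing u t ≤ C := by
  refine csSup_le (nonempty_Iic.image _) ?_
  rintro _ ⟨s, hs, rfl⟩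
  exact max_le hC (H s hs)

lemma pushing_nonneg (u : ℝ → ℝ) (t : ℝ) : 0 ≤ pushing u t := by
  refine Real.sSup_nonneg ?_
  rintro _ ⟨s, -, rfl⟩
  exact le_max_left _ _

lemma pushing_eq_zero {t : ℝ} (H : ∀ s ≤ t, 0 ≤ u s) : pushing u t = 0 :=
  le_antisymm (pushing_le le_rfl fun s hs => by linarith [H s hs]) (pushing_nonneg u t)

lemma neg_le_pushing {s t : ℝ} (hb : BddAbove ((fun s => max 0 (-u s)) '' Iic t)) (hst : s ≤ t) :
    -u s ≤ pushing u t :=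
  (le_max_right _ _).trans (le_csSup hb ⟨s, hst, rfl⟩)

lemma monotone_pushing (hb : ∀ t, BddAbove ((fun s => max 0 (-u s)) '' Iic t)) :
    Monotone (pushing u) := fun _ t hst =>
  pushing_le (pushing_nonneg u t) fun _ hr => neg_le_pushing (hb t) (hr.trans hst)

/-- A push after time `s` is needed only for a fall of `u` below `u s`, and `h` bounds that fall. -/
lemma pushing_sub_le (hh : Monotone h) (hu : ∀ s t, s ≤ t → |u t - u s| ≤ h t - h s)
    (h0 : ∀ s ≤ 0, 0 ≤ u s) {s t : ℝ} (hst : s ≤ t) :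
    pushing u t - pushing u s ≤ h t - h s := by
  have hb := bddAbove_image_negPart hh hu h0 s
  have hp := pushing_nonneg u s
  have := hh hst
  rw [sub_le_iff_le_add]
  refine pushing_le (by linarith) fun r hr => ?_
  rcases le_total r s with h1 | h1
  · linarith [neg_le_pushing hb h1]
  · linarith [neg_le_pushing hb le_rfl, neg_abs_le (u r - u s), hu s r h1, hh hr]

lemma abs_pushing_sub_le {t C : ℝ} (hbu : BddAbove ((fun s => max 0 (-u s)) '' Iic t))
    (hbv : BddAbove ((fun s => max 0 (-v s)) '' Iic t)) (H : ∀ s ≤ t, |u s - v s| ≤ C) :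
    |pushing u t - pushing v t| ≤ C := by
  have hC : 0 ≤ C := (abs_nonneg _).trans (H t le_rfl)
  have h1 := pushing_nonneg u t
  have h2 := pushing_nonneg v t
  rw [abs_sub_le_iff, sub_le_iff_le_add, sub_le_iff_le_add]
  constructor
  · refine pushing_le (by linarith) fun s hs => ?_
    linarith [neg_le_pushing hbv hs, neg_abs_le (u s - v s), H s hs]
  · refine pushing_le (by linarith) fun s hs => ?_
    linarith [neg_le_pushing hbu hs, le_abs_self (u s - v s), H s hs]

/-- The pushing term grows only at times when the reflected path vanishes. -/
lemma deriv_pushing_eq_zero (hb : ∀ t, BddAbove ((fun s => max 0 (-u s)) '' Iic t)) {t m : ℝ}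
    (hc : ContinuousAt u t) (hpos : 0 < u t + pushing u t) (hm : HasDerivAt (pushing u) m t) :
    m = 0 := by
  have hev : ∀ᶠ s in 𝓝 t, -u s < pushing u t :=
    hc.neg.eventually (gt_mem_nhds (by rw [Pi.neg_apply]; linarith))
  obtain ⟨δ, hδ, hball⟩ := Metric.eventually_nhds_iff.1 hev
  -- A right neighbourhood suffices, since `m` is also the one-sided derivative. There the enlarged
  -- supremum meets only new values below `pushing u t`.
  have hconst : ∀ᶠ s in 𝓝[Ici t] t, pushing u s = pushing u t := by
    filter_upwards [self_mem_nhdsWithin, mem_nhdsWithin_of_mem_nhds (Metric.ball_mem_nhds t hδ)]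
      with s hs hsb
    refine le_antisymm (pushing_le (pushing_nonneg u t) fun r hr => ?_) (monotone_pushing hb hs)
    rcases le_total r t with h1 | h1
    · exact neg_le_pushing (hb t) h1
    · refine (hball ?_).le
      rw [Metric.mem_ball, Real.dist_eq, abs_of_nonneg (sub_nonneg.2 hs)] at hsb
      rw [Real.dist_eq, abs_of_nonneg (sub_nonneg.2 h1)]
      linarith
  have h0 : HasDerivWithinAt (pushing u) 0 (Ici t) t :=
    (hasDerivWithinAt_const t (Ici t) (pushing u t)).congr_of_eventuallyEq hconst rfl
  exact (uniqueDiffWithinAt_Ici t).eq_deriv _ hm.hasDerivWithinAt h0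

end Pushing

/-- If the increments of `f` are dominated by those of an absolutely continuous function, then `f`
is absolutely continuous. -/
lemma absolutelyContinuousOnInterval_of_dist_le {X Y : Type*} [PseudoMetricSpace X]
    [PseudoMetricSpace Y] {f : ℝ → X} {g : ℝ → Y} {a b C : ℝ}
    (hg : AbsolutelyContinuousOnInterval g a b)
    (H : ∀ s t, dist (f s) (f t) ≤ C * dist (g s) (g t)) :
    AbsolutelyContinuousOnInterval f a b := by
  refine squeeze_zero (fun _ => Finset.sum_nonneg fun _ _ => dist_nonneg) (fun I => ?_)
    (by simpa using Tendsto.const_mul C hg)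
  rw [Finset.mul_sum]
  exact Finset.sum_le_sum fun i _ => H _ _

lemma locallyIntegrable_norm {X F : Type*} [TopologicalSpace X] [MeasurableSpace X]
    [NormedAddCommGroup F] {μ : Measure X} {f : X → F} (hf : LocallyIntegrable f μ) :
    LocallyIntegrable (fun x => ‖f x‖) μ := fun x => (hf x).norm

lemma intervalIntegrable_of_locallyIntegrable {F : Type*} [NormedAddCommGroup F] {μ : Measure ℝ}
    {f : ℝ → F} (hf : LocallyIntegrable f μ) (a b : ℝ) : IntervalIntegrable f μ a b :=
  (hf.integrableOn_isCompact isCompact_uIcc).intervalIntegrable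

/-! ### Reflection in the orthant for a forcing of time alone. -/

section Path

variable {d : ℕ}

lemma abs_coord_le (x : EuclideanSpace ℝ (Fin d)) (i : Fin d) : |x i| ≤ ‖x‖ := by
  simpa using PiLp.norm_apply_le x i

lemma norm_le_of_coord_le {x : EuclideanSpace ℝ (Fin d)} {C : ℝ} (H : ∀ i, |x i| ≤ C) :
    ‖x‖ ≤ d * C := by
  have h1 : ‖x‖ ≤ ∑ i, ‖x i‖ := by
    conv_lhs => rw [← (EuclideanSpace.basisFun (Fin d) ℝ).sum_repr x]
    refine (norm_sum_le _ _).trans (Finset.sum_le_sum fun i _ => ?_)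
    simp [norm_smul]
  refine h1.trans ((Finset.sum_le_sum fun i _ => H i).trans ?_)
  simp

/-- The free path `x₀ - ∫₀ᵗ f`. -/
noncomputable def freePath (x₀ : EuclideanSpace ℝ (Fin d)) (f : ℝ → EuclideanSpace ℝ (Fin d))
    (t : ℝ) : EuclideanSpace ℝ (Fin d) := x₀ - ∫ s in (0 : ℝ)..t, f s

/-- The path `x₀ - ∫₀ᵗ f` reflected, coordinate by coordinate, at the boundary of the orthant. -/
noncomputable def reflectedPath (x₀ : EuclideanSpace ℝ (Fin d)) (f : ℝ → EuclideanSpace ℝ (Fin d))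
    (t : ℝ) : EuclideanSpace ℝ (Fin d) :=
  WithLp.toLp 2 fun i => freePath x₀ f t i + pushing (fun s => freePath x₀ f s i) t

variable {x₀ : EuclideanSpace ℝ (Fin d)} {f g : ℝ → EuclideanSpace ℝ (Fin d)}

lemma reflectedPath_apply (x₀ : EuclideanSpace ℝ (Fin d)) (f : ℝ → EuclideanSpace ℝ (Fin d)) (t : ℝ)
    (i : Fin d) :
    reflectedPath x₀ f t i = freePath x₀ f t i + pushing (fun s => freePath x₀ f s i) t := rfl

lemma freePath_of_nonpos (hf0 : ∀ s ≤ 0, f s = 0) {t : ℝ} (ht : t ≤ 0) : freePath x₀ f t = x₀ := by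
  have : ∫ s in (0 : ℝ)..t, f s = ∫ s in (0 : ℝ)..t, (0 : EuclideanSpace ℝ (Fin d)) := by
    refine intervalIntegral.integral_congr fun s hs => hf0 s ?_
    rw [uIcc_of_ge ht] at hs
    exact hs.2
  simp [freePath, this]

lemma monotone_integral_norm (hf : LocallyIntegrable f) :
    Monotone fun t => ∫ s in (0 : ℝ)..t, ‖f s‖ := by
  intro s t hst
  have hi : ∀ a b, IntervalIntegrable (fun s => ‖f s‖) volume a b :=
    intervalIntegrable_of_locallyIntegrable (locallyIntegrable_norm hf)
  have : 0 ≤ ∫ r in s..t, ‖f r‖ :=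
    intervalIntegral.integral_nonneg hst fun _ _ => norm_nonneg _
  have h2 := intervalIntegral.integral_interval_sub_left (hi 0 t) (hi 0 s)
  simp only
  linarith

lemma norm_freePath_sub_le (hf : LocallyIntegrable f) {s t : ℝ} (hst : s ≤ t) :
    ‖freePath x₀ f t - freePath x₀ f s‖ ≤
      (∫ r in (0 : ℝ)..t, ‖f r‖) - ∫ r in (0 : ℝ)..s, ‖f r‖ := by
  rw [intervalIntegral.integral_interval_sub_left
    (intervalIntegrable_of_locallyIntegrable (locallyIntegrable_norm hf) _ _)
    (intervalIntegrable_of_locallyIntegrable (locallyIntegrable_norm hf) _ _)]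
  have : freePath x₀ f t - freePath x₀ f s = -∫ r in s..t, f r := by
    rw [← intervalIntegral.integral_interval_sub_left
      (intervalIntegrable_of_locallyIntegrable hf 0 t)
      (intervalIntegrable_of_locallyIntegrable hf 0 s)]
    simp only [freePath]
    abel
  rw [this, norm_neg]
  exact intervalIntegral.norm_integral_le_integral_norm hst

lemma abs_freePath_sub_le (hf : LocallyIntegrable f) (i : Fin d) (s t : ℝ) (hst : s ≤ t) :
    |freePath x₀ f t i - freePath x₀ f s i| ≤
      (∫ r in (0 : ℝ)..t, ‖f r‖) - ∫ r in (0 : ℝ)..s, ‖f r‖ :=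
  (abs_coord_le (freePath x₀ f t - freePath x₀ f s) i).trans (norm_freePath_sub_le hf hst)

lemma freePath_nonneg_of_nonpos (hx₀ : x₀ ∈ orthant d) (hf0 : ∀ s ≤ 0, f s = 0) (i : Fin d)
    (s : ℝ) (hs : s ≤ 0) : 0 ≤ freePath x₀ f s i := by
  rw [freePath_of_nonpos hf0 hs]
  exact hx₀ i

lemma bddAbove_image_freePath (hx₀ : x₀ ∈ orthant d) (hf : LocallyIntegrable f)
    (hf0 : ∀ s ≤ 0, f s = 0) (i : Fin d) (t : ℝ) :
    BddAbove ((fun s => max 0 (-freePath x₀ f s i)) '' Iic t) :=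
  bddAbove_image_negPart (u := fun s => freePath x₀ f s i) (monotone_integral_norm hf)
    (abs_freePath_sub_le hf i) (freePath_nonneg_of_nonpos hx₀ hf0 i) t

lemma reflectedPath_mem (hx₀ : x₀ ∈ orthant d) (hf : LocallyIntegrable f)
    (hf0 : ∀ s ≤ 0, f s = 0) (t : ℝ) : reflectedPath x₀ f t ∈ orthant d := by
  intro i
  rw [reflectedPath_apply]
  have := neg_le_pushing (u := fun s => freePath x₀ f s i)
    (bddAbove_image_freePath hx₀ hf hf0 i t) le_rfl
  linarith

lemma reflectedPath_of_nonpos (hx₀ : x₀ ∈ orthant d) (hf0 : ∀ s ≤ 0, f s = 0) {t : ℝ}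
    (ht : t ≤ 0) : reflectedPath x₀ f t = x₀ := by
  ext i
  rw [reflectedPath_apply, pushing_eq_zero, freePath_of_nonpos hf0 ht, add_zero]
  exact fun s hs => freePath_nonneg_of_nonpos hx₀ hf0 i s (hs.trans ht)

lemma reflectedPath_zero (hx₀ : x₀ ∈ orthant d) (t : ℝ) :
    reflectedPath x₀ (fun _ => 0) t = x₀ := by
  ext i
  rw [reflectedPath_apply, pushing_eq_zero]
  · simp [freePath]
  · intro s _
    simpa [freePath] using hx₀ i

/-- The 2 counts the free path and the push, each controlled by the integral of `‖f‖`; `d` comes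
from summing over coordinates. -/
lemma dist_reflectedPath_le (hx₀ : x₀ ∈ orthant d) (hf : LocallyIntegrable f)
    (hf0 : ∀ s ≤ 0, f s = 0) (s t : ℝ) :
    dist (reflectedPath x₀ f s) (reflectedPath x₀ f t) ≤
      (2 * d) * dist (∫ r in (0 : ℝ)..s, ‖f r‖) (∫ r in (0 : ℝ)..t, ‖f r‖) := by
  wlog hst : s ≤ t generalizing s t
  · rw [dist_comm, dist_comm (∫ r in (0 : ℝ)..s, ‖f r‖)]
    exact this t s (le_of_not_ge hst)
  have hmono := monotone_integral_norm hf
  rw [dist_comm, dist_comm (∫ r in (0 : ℝ)..s, ‖f r‖), dist_eq_norm, Real.dist_eq,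
    abs_of_nonneg (sub_nonneg.2 (hmono hst)), mul_comm 2, mul_assoc]
  refine norm_le_of_coord_le fun i => ?_
  have h1 := abs_freePath_sub_le (x₀ := x₀) hf i s t hst
  have h2 := pushing_sub_le (u := fun s => freePath x₀ f s i) hmono
    (abs_freePath_sub_le hf i) (freePath_nonneg_of_nonpos hx₀ hf0 i) hst
  have h3 := monotone_pushing (u := fun s => freePath x₀ f s i)
    (bddAbove_image_freePath hx₀ hf hf0 i) hst
  rw [PiLp.sub_apply, reflectedPath_apply, reflectedPath_apply, abs_le]
  rw [abs_le] at h1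
  constructor <;> linarith

lemma continuous_reflectedPath (hx₀ : x₀ ∈ orthant d) (hf : LocallyIntegrable f)
    (hf0 : ∀ s ≤ 0, f s = 0) : Continuous (reflectedPath x₀ f) := by
  have hc : Continuous fun t => ∫ r in (0 : ℝ)..t, ‖f r‖ :=
    intervalIntegral.continuous_primitive
      (intervalIntegrable_of_locallyIntegrable (locallyIntegrable_norm hf)) 0
  refine continuous_iff_continuousAt.2 fun t => tendsto_iff_dist_tendsto_zero.2 ?_
  refine squeeze_zero (fun _ => dist_nonneg)
    (fun s => dist_reflectedPath_le hx₀ hf hf0 s t) ?_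
  simpa using (tendsto_iff_dist_tendsto_zero.1 (hc.tendsto t)).const_mul (2 * (d : ℝ))

lemma absolutelyContinuousOnInterval_reflectedPath (hx₀ : x₀ ∈ orthant d)
    (hf : LocallyIntegrable f) (hf0 : ∀ s ≤ 0, f s = 0) (T : ℝ) :
    AbsolutelyContinuousOnInterval (reflectedPath x₀ f) 0 T :=
  absolutelyContinuousOnInterval_of_dist_le
    ((intervalIntegrable_of_locallyIntegrable (locallyIntegrable_norm hf) 0
      T).absolutelyContinuousOnInterval_intervalIntegral left_mem_uIcc)
    (dist_reflectedPath_le hx₀ hf hf0)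

/-- Running suprema are nonexpansive in the sup norm up to time `t`. The bound sees only the past of
`t`, which is what makes the weighted contraction possible. -/
lemma norm_reflectedPath_sub_le (hx₀ : x₀ ∈ orthant d) (hf : LocallyIntegrable f)
    (hf0 : ∀ s ≤ 0, f s = 0) (hg : LocallyIntegrable g) (hg0 : ∀ s ≤ 0, g s = 0) {t : ℝ}
    (ht : 0 ≤ t) :
    ‖reflectedPath x₀ f t - reflectedPath x₀ g t‖ ≤
      (2 * d) * ∫ s in (0 : ℝ)..t, ‖f s - g s‖ := by
  have hmono := monotone_integral_norm (hf.sub hg)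
  have key : ∀ i, ∀ s ≤ t, |freePath x₀ f s i - freePath x₀ g s i| ≤
      ∫ s in (0 : ℝ)..t, ‖f s - g s‖ := by
    intro i s hs
    rcases le_total s 0 with h1 | h1
    · rw [freePath_of_nonpos hf0 h1, freePath_of_nonpos hg0 h1, sub_self, abs_zero]
      exact intervalIntegral.integral_nonneg ht fun _ _ => norm_nonneg _
    · refine (abs_coord_le (freePath x₀ f s - freePath x₀ g s) i).trans ?_
      have : freePath x₀ f s - freePath x₀ g s = -∫ r in (0 : ℝ)..s, (f r - g r) := by
        rw [intervalIntegral.integral_sub (intervalIntegrable_of_locallyIntegrable hf _ _)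
          (intervalIntegrable_of_locallyIntegrable hg _ _)]
        simp only [freePath]
        abel
      rw [this, norm_neg]
      exact (intervalIntegral.norm_integral_le_integral_norm h1).trans (hmono hs)
  rw [mul_comm 2, mul_assoc]
  refine norm_le_of_coord_le fun i => ?_
  have h2 := abs_pushing_sub_le (u := fun s => freePath x₀ f s i)
    (v := fun s => freePath x₀ g s i) (bddAbove_image_freePath hx₀ hf hf0 i t)
    (bddAbove_image_freePath hx₀ hg hg0 i t) (key i)
  have h1 := key i t le_rfl
  rw [PiLp.sub_apply, reflectedPath_apply, reflectedPath_apply]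
  rw [abs_le] at h1 h2 ⊢
  constructor <;> linarith

/-- The reflected path solves the reflected problem with a forcing that depends on time only. -/
lemma reflectedPath_inclusion (hx₀ : x₀ ∈ orthant d) (hf : LocallyIntegrable f)
    (hf0 : ∀ s ≤ 0, f s = 0) :
    ∀ᵐ t, ∃ v, HasDerivAt (reflectedPath x₀ f) v t ∧
      -v ∈ normalCone (orthant d) (reflectedPath x₀ f t) + {f t} := by
  have hb := bddAbove_image_freePath hx₀ hf hf0
  have hmono := fun i => monotone_pushing (u := fun s => freePath x₀ f s i) (hb i)
  filter_upwards [LocallyIntegrable.ae_hasDerivAt_integral hf,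
    ae_all_iff.2 fun i => (hmono i).ae_differentiableAt]
    with t htf htm
  have hfree : HasDerivAt (freePath x₀ f) (-f t) t := by
    simpa using! (htf 0).const_sub x₀
  set p : Fin d → ℝ → ℝ := fun i => pushing (fun s => freePath x₀ f s i)
  set m : EuclideanSpace ℝ (Fin d) := WithLp.toLp 2 fun i => deriv (p i) t with hm
  have hpush : HasDerivAt
      (fun s => (WithLp.toLp 2 fun i => p i s : EuclideanSpace ℝ (Fin d))) m t := by
    have h1 : HasDerivAt (fun s i => p i s) (fun i => deriv (p i) t) t :=
      hasDerivAt_pi.2 fun i => (htm i).hasDerivAt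
    exact (PiLp.continuousLinearEquiv 2 ℝ fun _ : Fin d => ℝ).symm.hasFDerivAt.comp_hasDerivAt t h1
  have hcoord : ∀ i, ContinuousAt (fun s => freePath x₀ f s i) t := fun i =>
    (EuclideanSpace.proj (𝕜 := ℝ) i).continuous.continuousAt.comp hfree.continuousAt
  -- Since `m ≥ 0` and `m i * x i = 0` for every `i`, the pairing of `-m` with `y - x` is `-∑ m i *
  -- y i ≤ 0`.
  refine ⟨-f t + m, hfree.add hpush, Set.mem_add.2
    ⟨-m, ⟨reflectedPath_mem hx₀ hf hf0 t, fun y hy => ?_⟩, f t, rfl, by abel⟩⟩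
  rw [PiLp.inner_apply]
  refine Finset.sum_nonpos fun i _ => ?_
  have hmi : 0 ≤ deriv (p i) t := (hmono i).deriv_nonneg
  have hxi := reflectedPath_mem hx₀ hf hf0 t i
  have hcompl : deriv (p i) t * reflectedPath x₀ f t i = 0 := by
    rcases hxi.eq_or_lt with h1 | h1
    · rw [← h1, mul_zero]
    · rw [deriv_pushing_eq_zero (hb i) (hcoord i) h1 (htm i).hasDerivAt, zero_mul]
  have hyi := mul_nonneg hmi (hy i)
  simp only [hm, PiLp.neg_apply, PiLp.sub_apply, RCLike.inner_apply, conj_trivial]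
  nlinarith

end Path

/-! ### Uniqueness by monotonicity and Gronwall. -/

section Uniqueness

variable {d : ℕ}

/-- Velocities of two solutions at a common time: the normal cone is monotone. -/
lemma inner_sub_velocity_le {F : EuclideanSpace ℝ (Fin d) → EuclideanSpace ℝ (Fin d)} {c : ℝ}
    (hF : ∀ x y, ‖F x - F y‖ ≤ c * ‖x - y‖)
    {S : Set (EuclideanSpace ℝ (Fin d))} {x y v w : EuclideanSpace ℝ (Fin d)}
    (hv : -v ∈ normalCone S x + {F x}) (hw : -w ∈ normalCone S y + {F y}) :
    inner ℝ (x - y) (v - w) ≤ c * ‖x - y‖ ^ 2 := by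
  obtain ⟨ξ, ⟨hxS, hξ⟩, _, rfl, h1⟩ := Set.mem_add.1 hv
  obtain ⟨η, ⟨hyS, hη⟩, _, rfl, h2⟩ := Set.mem_add.1 hw
  have hξy := hξ y hyS
  have hηx := hη x hxS
  have hvw : v - w = (η - ξ) - (F x - F y) := by
    rw [← neg_neg v, ← neg_neg w, ← h1, ← h2]
    abel
  have hcs : -inner ℝ (x - y) (F x - F y) ≤ c * ‖x - y‖ ^ 2 := by
    have h3 := neg_le_of_abs_le (abs_real_inner_le_norm (x - y) (F x - F y))
    have h4 := mul_le_mul_of_nonneg_left (hF x y) (norm_nonneg (x - y))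
    nlinarith
  have hsplit : inner ℝ (x - y) (v - w)
      = inner ℝ ξ (y - x) + inner ℝ η (x - y) - inner ℝ (x - y) (F x - F y) := by
    rw [hvw, inner_sub_right, inner_sub_right, real_inner_comm η, real_inner_comm ξ,
      ← neg_sub x y, inner_neg_right]
    ring
  rw [hsplit]
  linarith

/-- An absolutely continuous function with almost everywhere nonpositive derivative does not
increase. -/
lemma le_of_ae_hasDerivAt_nonpos {q : ℝ → ℝ} {a b : ℝ} (hab : a ≤ b)
    (hq : AbsolutelyContinuousOnInterval q a b)
    (hq' : ∀ᵐ t ∂(volume.restrict (Ioi a)), ∃ v ≤ 0, HasDerivAt q v t) : q b ≤ q a := by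
  have h1 := hq.integral_deriv_eq_sub
  have h2 : ∫ t in a..b, deriv q t ≤ 0 := by
    rw [intervalIntegral.integral_of_le hab]
    refine integral_nonpos_of_ae ?_
    filter_upwards [ae_restrict_of_ae_restrict_of_subset Ioc_subset_Ioi_self hq']
      with t ⟨v, hv, hd⟩
    rw [hd.deriv]
    exact hv
  linarith

lemma IsSolution.eqOn {F : ℝ → EuclideanSpace ℝ (Fin d) → EuclideanSpace ℝ (Fin d)} {c : ℝ}
    (hF : ∀ t, 0 < t → ∀ x y, ‖F t x - F t y‖ ≤ c * ‖x - y‖)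
    {x₀ : EuclideanSpace ℝ (Fin d)} {x y : ℝ → EuclideanSpace ℝ (Fin d)}
    (hx : IsSolution F x₀ x) (hy : IsSolution F x₀ y) : EqOn x y (Ici 0) := by
  intro T hT
  rcases (mem_Ici.1 hT).eq_or_lt with rfl | hT
  · rw [hx.initial, hy.initial]
  have hw := (hx.absolutelyContinuous T hT).fun_sub (hy.absolutelyContinuous T hT)
  have hn : AbsolutelyContinuousOnInterval (fun t => ‖x t - y t‖) 0 T :=
    squeeze_zero (fun _ => Finset.sum_nonneg fun _ _ => dist_nonneg)
      (fun I => Finset.sum_le_sum fun i _ => dist_norm_norm_le _ _ |>.trans_eq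
        (dist_eq_norm _ _).symm) hw
  have he : AbsolutelyContinuousOnInterval (fun t : ℝ => Real.exp (-(2 * c) * t)) 0 T :=
    ContDiffOn.absolutelyContinuousOnInterval (by fun_prop)
  -- The derivative of `exp (-2ct) ‖x - y‖²` is `2 exp (-2ct) (⟨x - y, x' - y'⟩ - c ‖x - y‖²)`,
  -- nonpositive by monotonicity of the normal cone.
  have hq := he.fun_mul (hn.fun_mul hn)
  have hle := le_of_ae_hasDerivAt_nonpos hT.le hq (by
    filter_upwards [hx.inclusion, hy.inclusion, ae_restrict_mem measurableSet_Ioi]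
      with t ⟨v, hv, hvN⟩ ⟨w, hw, hwN⟩ ht
    have hin := inner_sub_velocity_le (hF t ht) hvN hwN
    have hd := (((hasDerivAt_id t).const_mul (-(2 * c))).exp).mul (hv.sub hw).norm_sq
    refine ⟨_, ?_, hd.congr_of_eventuallyEq (.of_forall fun s => ?_)⟩
    · have hexp := Real.exp_pos (-(2 * c) * t)
      simp only [id, Pi.sub_apply]
      nlinarith [mul_nonneg hexp.le (sub_nonneg.2 hin)]
    · simp [pow_two])
  simp only [hx.initial, hy.initial, sub_self, norm_zero, mul_zero] at hle
  have hexp := Real.exp_pos (-(2 * c) * T)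
  have h0 : ‖x T - y T‖ = 0 := by
    by_contra hne
    have : 0 < ‖x T - y T‖ := lt_of_le_of_ne (norm_nonneg _) (Ne.symm hne)
    have := mul_pos hexp (mul_pos this this)
    linarith
  exact sub_eq_zero.1 (norm_eq_zero.1 h0)

end Uniqueness

/-! ### Existence by a weighted contraction. -/

section Existence

variable {d : ℕ}

/-- Composition of a Carathéodory function with a continuous path. -/
lemma aestronglyMeasurable_comp_path {X F : Type*} [TopologicalSpace X]
    [TopologicalSpace.PseudoMetrizableSpace X] [TopologicalSpace F]
    [TopologicalSpace.PseudoMetrizableSpace F] [AddCommMonoid F] [ContinuousAdd F]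
    {μ : Measure ℝ} {G : ℝ → X → F} (hG : ∀ t, Continuous (G t))
    (hm : ∀ z, AEStronglyMeasurable (fun t => G t z) μ) {y : ℝ → X} (hy : StronglyMeasurable y) :
    AEStronglyMeasurable (fun t => G t (y t)) μ := by
  -- Along a simple path the composite is a finite sum of slices cut off to measurable sets;
  -- continuity in space passes to the limit.
  refine aestronglyMeasurable_of_tendsto_ae atTop (f := fun n t => G t (hy.approx n t)) ?_
    (.of_forall fun t => ((hG t).tendsto _).comp (hy.tendsto_approx t))
  intro n
  have : (fun t => G t (hy.approx n t)) = fun t => ∑ z ∈ (hy.approx n).range,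
      ((hy.approx n) ⁻¹' {z}).indicator (fun t => G t z) t := by
    ext t
    rw [Finset.sum_eq_single (hy.approx n t)]
    · simp
    · intro z _ hz
      exact indicator_of_notMem (fun h => hz h.symm) _
    · intro h
      exact absurd (SimpleFunc.mem_range_self _ t) h
  rw [this]
  exact Finset.aestronglyMeasurable_fun_sum _ fun z _ =>
    (hm z).indicator ((hy.approx n).measurableSet_preimage _)

variable {G : ℝ → EuclideanSpace ℝ (Fin d) → EuclideanSpace ℝ (Fin d)} {c : ℝ}
  {x₀ : EuclideanSpace ℝ (Fin d)}

lemma locallyIntegrable_comp_path (hL : ∀ t x y, ‖G t x - G t y‖ ≤ c * ‖x - y‖)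
    (hG : ∀ z, LocallyIntegrable fun t => G t z) {y : ℝ → EuclideanSpace ℝ (Fin d)}
    (hy : Continuous y) : LocallyIntegrable fun t => G t (y t) := by
  have hGc : ∀ t, Continuous (G t) := fun t =>
    (LipschitzWith.of_dist_le' (K := c) fun x y => by
      simpa [dist_eq_norm] using hL t x y).continuous
  have hbound : LocallyIntegrable ((fun t => ‖G t 0‖) + fun t => c * ‖y t‖) :=
    (locallyIntegrable_norm (hG 0)).add
      (by fun_prop : Continuous fun t => c * ‖y t‖).locallyIntegrable
  refine hbound.mono (aestronglyMeasurable_comp_path hGc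
    (fun z => (hG z).aestronglyMeasurable) hy.stronglyMeasurable) (.of_forall fun t => ?_)
  refine le_trans ?_ (le_abs_self _)
  have h1 := hL t (y t) 0
  have h2 := norm_le_norm_add_norm_sub' (G t (y t)) (G t 0)
  rw [sub_zero] at h1
  simp only [Pi.add_apply]
  linarith

/-- The weight, growing in time, with respect to which the solution map is a contraction. -/
noncomputable def weight (G : ℝ → EuclideanSpace ℝ (Fin d) → EuclideanSpace ℝ (Fin d))
    (x₀ : EuclideanSpace ℝ (Fin d)) (K t : ℝ) : ℝ :=
  Real.exp (K * max t 0) * (1 + ‖x₀‖ + 2 * d * ∫ s in (0 : ℝ)..max t 0, ‖G s 0‖)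

lemma continuous_weight (hG : ∀ z, LocallyIntegrable fun t => G t z) (K : ℝ) :
    Continuous (weight G x₀ K) := by
  have hc : Continuous fun t => ∫ r in (0 : ℝ)..t, ‖G r 0‖ :=
    intervalIntegral.continuous_primitive
      (intervalIntegrable_of_locallyIntegrable (locallyIntegrable_norm (hG 0))) 0
  have hc' : Continuous fun t : ℝ => ∫ r in (0 : ℝ)..max t 0, ‖G r 0‖ :=
    hc.comp (by fun_prop : Continuous fun t : ℝ => max t 0)
  unfold weight
  fun_prop

lemma integral_norm_nonneg (t : ℝ) : 0 ≤ ∫ s in (0 : ℝ)..max t 0, ‖G s 0‖ :=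
  intervalIntegral.integral_nonneg (le_max_right t 0) fun _ _ => norm_nonneg _

lemma weight_pos (K t : ℝ) : 0 < weight G x₀ K t := by
  have := integral_norm_nonneg (G := G) t
  unfold weight
  positivity

/-- This is the purpose of the second factor of `weight`: the image of the zero path is bounded
relative to it, so the rescaled solution map preserves bounded functions. -/
lemma norm_reflectedPath_le_weight (hG : ∀ z, LocallyIntegrable fun t => G t z)
    (hG0 : ∀ t ≤ 0, ∀ z, G t z = 0) (hx₀ : x₀ ∈ orthant d) {K : ℝ} (hK : 0 ≤ K) (t : ℝ) :
    ‖reflectedPath x₀ (fun s => G s 0) t‖ ≤ weight G x₀ K t := by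
  have hint := integral_norm_nonneg (G := G) t
  have hexp : 1 ≤ Real.exp (K * max t 0) :=
    Real.one_le_exp (mul_nonneg hK (le_max_right t 0))
  have hg : 1 + ‖x₀‖ + 2 * d * ∫ s in (0 : ℝ)..max t 0, ‖G s 0‖ ≤ weight G x₀ K t :=
    le_mul_of_one_le_left (by positivity) hexp
  refine le_trans ?_ hg
  rcases le_total t 0 with ht | ht
  · rw [reflectedPath_of_nonpos hx₀ (fun s hs => hG0 s hs 0) ht]
    have : 0 ≤ 2 * (d : ℝ) * ∫ s in (0 : ℝ)..max t 0, ‖G s 0‖ := by positivity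
    linarith
  · have h1 := norm_reflectedPath_sub_le hx₀ (hG 0) (fun s hs => hG0 s hs 0)
      (g := fun _ => 0) locallyIntegrable_zero (fun _ _ => rfl) ht
    rw [reflectedPath_zero hx₀] at h1
    simp only [sub_zero] at h1
    rw [max_eq_left ht]
    linarith [norm_le_norm_add_norm_sub' (reflectedPath x₀ (fun s => G s 0) t) x₀]

lemma norm_reflectedPath_sub_le_weight (hc : 0 ≤ c)
    (hL : ∀ t x y, ‖G t x - G t y‖ ≤ c * ‖x - y‖)
    (hG : ∀ z, LocallyIntegrable fun t => G t z) (hG0 : ∀ t ≤ 0, ∀ z, G t z = 0)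
    (hx₀ : x₀ ∈ orthant d) {K D : ℝ} (hK : 0 < K) (hKc : 2 * (2 * d * c) ≤ K)
    {y z : ℝ → EuclideanSpace ℝ (Fin d)} (hy : Continuous y) (hz : Continuous z)
    (hyz : ∀ s, ‖y s - z s‖ ≤ D * weight G x₀ K s) (t : ℝ) :
    ‖reflectedPath x₀ (fun s => G s (y s)) t - reflectedPath x₀ (fun s => G s (z s)) t‖ ≤
      D / 2 * weight G x₀ K t := by
  have hD : 0 ≤ D := nonneg_of_mul_nonneg_left ((norm_nonneg _).trans (hyz 0)) (weight_pos K 0)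
  have hw := weight_pos (G := G) (x₀ := x₀) K t
  rcases le_total t 0 with ht | ht
  · rw [reflectedPath_of_nonpos hx₀ (fun s hs => hG0 s hs _) ht,
      reflectedPath_of_nonpos hx₀ (fun s hs => hG0 s hs _) ht, sub_self, norm_zero]
    positivity
  set g : ℝ := 1 + ‖x₀‖ + 2 * d * ∫ s in (0 : ℝ)..t, ‖G s 0‖ with hg
  have hg0 : 0 ≤ g := by
    have : 0 ≤ ∫ s in (0 : ℝ)..t, ‖G s 0‖ :=
      intervalIntegral.integral_nonneg ht fun _ _ => norm_nonneg _
    positivity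
  have hyi := locallyIntegrable_comp_path hL hG hy
  have hzi := locallyIntegrable_comp_path hL hG hz
  have hpt : ∀ s ∈ Icc 0 t, ‖G s (y s) - G s (z s)‖ ≤ (c * D * g) * Real.exp (K * s) := by
    intro s hs
    have hmono : (∫ r in (0 : ℝ)..s, ‖G r 0‖) ≤ ∫ r in (0 : ℝ)..t, ‖G r 0‖ :=
      monotone_integral_norm (hG 0) hs.2
    -- The second factor of the weight is nondecreasing, so its value at `t` leaves the integral and
    -- only the exponential is integrated, gaining `1 / K`.
    have hws : weight G x₀ K s ≤ Real.exp (K * s) * g := by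
      rw [weight, max_eq_left hs.1, hg]
      gcongr
    calc ‖G s (y s) - G s (z s)‖ ≤ c * ‖y s - z s‖ := hL s _ _
      _ ≤ c * (D * (Real.exp (K * s) * g)) := by
          gcongr
          exact (hyz s).trans (by gcongr)
      _ = _ := by ring
  have hexp : ∫ s in (0 : ℝ)..t, Real.exp (K * s) = (Real.exp (K * t) - 1) / K := by
    rw [intervalIntegral.integral_comp_mul_left _ hK.ne', integral_exp]
    simp [div_eq_inv_mul]
  have hint : ∫ s in (0 : ℝ)..t, ‖G s (y s) - G s (z s)‖ ≤
      (c * D * g) * ((Real.exp (K * t) - 1) / K) := by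
    rw [← hexp, ← intervalIntegral.integral_const_mul]
    refine intervalIntegral.integral_mono_on ht
      (intervalIntegrable_of_locallyIntegrable (locallyIntegrable_norm (hyi.sub hzi)) 0 t)
      (Continuous.intervalIntegrable (by fun_prop) 0 t) hpt
  refine (norm_reflectedPath_sub_le hx₀ hyi (fun s hs => hG0 s hs _) hzi
    (fun s hs => hG0 s hs _) ht).trans ?_
  have hwt : weight G x₀ K t = Real.exp (K * t) * g := by rw [weight, max_eq_left ht]
  rw [hwt]
  calc (2 * d : ℝ) * ∫ s in (0 : ℝ)..t, ‖G s (y s) - G s (z s)‖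
      ≤ 2 * d * ((c * D * g) * ((Real.exp (K * t) - 1) / K)) := by gcongr
    _ ≤ 2 * d * ((c * D * g) * (Real.exp (K * t) / K)) := by gcongr; linarith
    _ = (2 * (2 * d * c)) * (D / 2 * (Real.exp (K * t) * g) / K) := by ring
    _ ≤ K * (D / 2 * (Real.exp (K * t) * g) / K) := by gcongr
    _ = D / 2 * (Real.exp (K * t) * g) := by field_simp

/-- The solution map has a fixed point. -/
lemma exists_eq_reflectedPath (hc : 0 ≤ c) (hL : ∀ t x y, ‖G t x - G t y‖ ≤ c * ‖x - y‖)
    (hG : ∀ z, LocallyIntegrable fun t => G t z) (hG0 : ∀ t ≤ 0, ∀ z, G t z = 0)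
    (hx₀ : x₀ ∈ orthant d) :
    ∃ x : ℝ → EuclideanSpace ℝ (Fin d), Continuous x ∧
      x = reflectedPath x₀ fun s => G s (x s) := by
  -- Twice the Lipschitz constant `2dc` yields the contraction factor `1/2`; the `+ 1` keeps `K`
  -- positive when `d` or `c` is zero.
  set K : ℝ := 2 * (2 * d * c) + 1 with hKdef
  have hK : 0 < K := by positivity
  have hKc : 2 * (2 * d * c) ≤ K := by linarith
  set w := weight G x₀ K with hw
  have hwc : Continuous w := continuous_weight hG K
  have hw0 : ∀ t, 0 < w t := weight_pos K
  set Φ := fun y : ℝ → EuclideanSpace ℝ (Fin d) => reflectedPath x₀ fun s => G s (y s) with hΦ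
  have hΦc : ∀ y, Continuous y → Continuous (Φ y) := fun y hy =>
    continuous_reflectedPath hx₀ (locallyIntegrable_comp_path hL hG hy) fun s hs => hG0 s hs _
  have hΦw : ∀ y z D, Continuous y → Continuous z → (∀ s, ‖y s - z s‖ ≤ D * w s) →
      ∀ t, ‖(w t)⁻¹ • Φ y t - (w t)⁻¹ • Φ z t‖ ≤ D / 2 := by
    intro y z D hy hz hyz t
    rw [← smul_sub, norm_smul, norm_inv, Real.norm_of_nonneg (hw0 t).le, inv_mul_le_iff₀ (hw0 t),
      mul_comm]
    exact norm_reflectedPath_sub_le_weight hc hL hG hG0 hx₀ hK hKc hy hz hyz t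
  have hsub : ∀ (v v' : BoundedContinuousFunction ℝ (EuclideanSpace ℝ (Fin d))) (s : ℝ),
      ‖w s • v s - w s • v' s‖ ≤ dist v v' * w s := by
    intro v v' s
    rw [← smul_sub, norm_smul, Real.norm_of_nonneg (hw0 s).le, mul_comm, ← dist_eq_norm]
    exact mul_le_mul_of_nonneg_right (BoundedContinuousFunction.dist_coe_le_dist s) (hw0 s).le
  have hcont : ∀ v : BoundedContinuousFunction ℝ (EuclideanSpace ℝ (Fin d)),
      Continuous fun s => w s • v s := fun v => hwc.smul v.continuous
  have hbound : ∀ (v : BoundedContinuousFunction ℝ (EuclideanSpace ℝ (Fin d))) (t : ℝ),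
      ‖(w t)⁻¹ • Φ (fun s => w s • v s) t‖ ≤ 1 + ‖v‖ / 2 := by
    intro v t
    have h1 := hΦw _ (fun _ => 0) _ (hcont v) continuous_const (fun s => by
      simpa using hsub v 0 s) t
    have h2 : ‖(w t)⁻¹ • Φ (fun _ => 0) t‖ ≤ 1 := by
      rw [norm_smul, norm_inv, Real.norm_of_nonneg (hw0 t).le, inv_mul_le_iff₀ (hw0 t), mul_one]
      exact norm_reflectedPath_le_weight hG hG0 hx₀ hK.le t
    linarith [norm_le_norm_add_norm_sub' ((w t)⁻¹ • Φ (fun s => w s • v s) t)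
      ((w t)⁻¹ • Φ (fun _ => 0) t)]
  -- Conjugating by the weight turns the weighted norm into the plain sup norm, so Banach's theorem
  -- applies in the complete space of bounded continuous functions.
  let Ψ : BoundedContinuousFunction ℝ (EuclideanSpace ℝ (Fin d)) →
      BoundedContinuousFunction ℝ (EuclideanSpace ℝ (Fin d)) := fun v =>
    BoundedContinuousFunction.ofNormedAddCommGroup (fun t => (w t)⁻¹ • Φ (fun s => w s • v s) t)
      ((hwc.inv₀ fun t => (hw0 t).ne').smul (hΦc _ (hcont v))) _ (hbound v)
  have hΨ : ContractingWith (1 / 2) Ψ := by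
    refine ⟨by norm_num, LipschitzWith.of_dist_le_mul fun v v' => ?_⟩
    have h0 : (((1 / 2 : NNReal) : ℝ)) * dist v v' = dist v v' / 2 := by push_cast; ring
    rw [h0]
    refine (BoundedContinuousFunction.dist_le (by positivity)).2 fun t => ?_
    rw [dist_eq_norm]
    exact hΦw _ _ _ (hcont v) (hcont v') (hsub v v') t
  set v := hΨ.fixedPoint
  have hv : Ψ v = v := hΨ.fixedPoint_isFixedPt
  refine ⟨fun s => w s • v s, hcont v, funext fun t => ?_⟩
  have ht : v t = (w t)⁻¹ • Φ (fun s => w s • v s) t := by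
    conv_lhs => rw [← hv]
    rfl
  change w t • v t = Φ (fun s => w s • v s) t
  rw [ht, smul_inv_smul₀ (hw0 t).ne']

end Existence

/-! ### The network forcing and its extension to all times. -/

section Forcing

variable {d : ℕ}

lemma norm_act_sub_le {σ : ℝ → ℝ} (hσ : LipschitzWith 1 σ) (x y : EuclideanSpace ℝ (Fin d)) :
    ‖act σ x - act σ y‖ ≤ ‖x - y‖ := by
  rw [EuclideanSpace.norm_eq, EuclideanSpace.norm_eq]
  refine Real.sqrt_le_sqrt (Finset.sum_le_sum fun i _ => ?_)
  gcongr
  simpa [act, dist_eq_norm] using hσ.dist_le_mul (x i) (y i)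

lemma norm_forcing_sub_le {A₁ A₂ : ℝ → Matrix (Fin d) (Fin d) ℝ}
    {b₁ b₂ : ℝ → EuclideanSpace ℝ (Fin d)} {σ : ℝ → ℝ} (hσ : LipschitzWith 1 σ) {c t : ℝ}
    (hA : ‖op (A₁ t)‖ * ‖op (A₂ t)‖ ≤ c) (x y : EuclideanSpace ℝ (Fin d)) :
    ‖forcing A₁ A₂ b₁ b₂ σ t x - forcing A₁ A₂ b₁ b₂ σ t y‖ ≤ c * ‖x - y‖ := by
  simp only [forcing, sub_sub_sub_cancel_right]
  rw [← map_sub]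
  calc _ ≤ ‖op (A₂ t)‖ * ‖act σ (op (A₁ t) x + b₁ t) - act σ (op (A₁ t) y + b₁ t)‖ :=
        (op (A₂ t)).le_opNorm _
    _ ≤ ‖op (A₂ t)‖ * ‖op (A₁ t) (x - y)‖ := by
        gcongr
        refine (norm_act_sub_le hσ _ _).trans_eq ?_
        rw [add_sub_add_right_eq_sub, map_sub]
    _ ≤ ‖op (A₂ t)‖ * (‖op (A₁ t)‖ * ‖x - y‖) := by
        gcongr
        exact (op (A₁ t)).le_opNorm _
    _ = ‖op (A₁ t)‖ * ‖op (A₂ t)‖ * ‖x - y‖ := by ring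
    _ ≤ c * ‖x - y‖ := by gcongr

/-- Including the endpoint in `Ici a` gives integrability up to `a`, so the extension by zero has no
singularity there. -/
lemma locallyIntegrable_indicator_Ioi {F : Type*} [NormedAddCommGroup F] {f : ℝ → F} {a : ℝ}
    (hf : LocallyIntegrableOn f (Ici a)) : LocallyIntegrable ((Ioi a).indicator f) := by
  refine locallyIntegrable_iff.2 fun k hk => ?_
  rw [IntegrableOn, integrable_indicator_iff measurableSet_Ioi, IntegrableOn,
    Measure.restrict_restrict measurableSet_Ioi]
  exact (hf.integrableOn_compact_subset inter_subset_left (hk.inter_left isClosed_Ici)).mono_set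
    (inter_subset_inter_left k Ioi_subset_Ici_self)

/-- Existence for a forcing that is Lipschitz in space and locally integrable in time. -/
lemma exists_isSolution {F : ℝ → EuclideanSpace ℝ (Fin d) → EuclideanSpace ℝ (Fin d)} {c : ℝ}
    (hc : 0 ≤ c) (hL : ∀ t, 0 < t → ∀ x y, ‖F t x - F t y‖ ≤ c * ‖x - y‖)
    (hF : ∀ z, LocallyIntegrableOn (fun t => F t z) (Ici 0))
    {x₀ : EuclideanSpace ℝ (Fin d)} (hx₀ : x₀ ∈ orthant d) :
    ∃ x, IsSolution F x₀ x ∧ ∀ t, x t ∈ orthant d := by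
  -- The cut-off is at the open half-line because the Lipschitz bound is known only for `t > 0`. It
  -- also freezes paths at `x₀` for `t ≤ 0`.
  set G : ℝ → EuclideanSpace ℝ (Fin d) → EuclideanSpace ℝ (Fin d) :=
    fun t z => (Ioi (0 : ℝ)).indicator (fun t => F t z) t with hGdef
  have hGpos : ∀ t, 0 < t → G t = F t := fun t ht =>
    funext fun z => indicator_of_mem (mem_Ioi.2 ht) _
  have hG0 : ∀ t ≤ 0, ∀ z, G t z = 0 := fun t ht z => indicator_of_notMem (notMem_Ioi.2 ht) _
  have hGL : ∀ t x y, ‖G t x - G t y‖ ≤ c * ‖x - y‖ := by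
    intro t x y
    rcases le_or_gt t 0 with ht | ht
    · rw [hG0 t ht, hG0 t ht, sub_zero, norm_zero]
      positivity
    · rw [hGpos t ht]
      exact hL t ht x y
  have hGi : ∀ z, LocallyIntegrable fun t => G t z := fun z =>
    locallyIntegrable_indicator_Ioi (hF z)
  obtain ⟨x, hxc, hx⟩ := exists_eq_reflectedPath hc hGL hGi hG0 hx₀
  have hf := locallyIntegrable_comp_path hGL hGi hxc
  have hf0 : ∀ s ≤ 0, G s (x s) = 0 := fun s hs => hG0 s hs _
  refine ⟨x, ⟨fun T _ => ?_, ?_, ?_⟩, fun t => ?_⟩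
  · rw [hx]
    exact absolutelyContinuousOnInterval_reflectedPath hx₀ hf hf0 T
  · filter_upwards [ae_restrict_of_ae (reflectedPath_inclusion hx₀ hf hf0),
      ae_restrict_mem measurableSet_Ioi] with t h ht
    rwa [← hx, hGpos t ht] at h
  · rw [hx]
    exact reflectedPath_of_nonpos hx₀ hf0 le_rfl
  · rw [hx]
    exact reflectedPath_mem hx₀ hf hf0 t

end Forcing

end ResNet

theorem theorem1 (d : ℕ) (c : ℝ) (hc : 0 < c)
    (A₁ A₂ : ℝ → Matrix (Fin d) (Fin d) ℝ) (b₁ b₂ : ℝ → EuclideanSpace ℝ (Fin d))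
    (σ : ℝ → ℝ)
    (hA : ∀ t : ℝ, 0 < t → ‖ResNet.op (A₁ t)‖ * ‖ResNet.op (A₂ t)‖ ≤ c)
    (hσ : LipschitzWith 1 σ) (hσ0 : σ 0 = 0)
    (hF : ∀ z : EuclideanSpace ℝ (Fin d),
      LocallyIntegrableOn (fun t => ResNet.forcing A₁ A₂ b₁ b₂ σ t z) (Ici (0 : ℝ)) volume)
    (x₀ : EuclideanSpace ℝ (Fin d)) (hx₀ : x₀ ∈ ResNet.orthant d) :
    ∃ x : ℝ → EuclideanSpace ℝ (Fin d),
      ResNet.IsSolution (ResNet.forcing A₁ A₂ b₁ b₂ σ) x₀ x ∧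
      (∀ t : ℝ, 0 ≤ t → x t ∈ ResNet.orthant d) ∧
      ∀ y : ℝ → EuclideanSpace ℝ (Fin d),
        ResNet.IsSolution (ResNet.forcing A₁ A₂ b₁ b₂ σ) x₀ y → EqOn y x (Ici (0 : ℝ)) := by
  have hL : ∀ t, 0 < t → ∀ x y, ‖ResNet.forcing A₁ A₂ b₁ b₂ σ t x -
      ResNet.forcing A₁ A₂ b₁ b₂ σ t y‖ ≤ c * ‖x - y‖ := fun t ht =>
    ResNet.norm_forcing_sub_le hσ (hA t ht)
  obtain ⟨x, hx, hmem⟩ := ResNet.exists_isSolution hc.le hL hF hx₀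
  exact ⟨x, hx, fun t _ => hmem t, fun y hy => hy.eqOn hL hx⟩
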